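/- Let $\mathfrak g$ be a real Lie algebra of dimension $2n\ge 4$ with a fixed orientation. An almost complex structure on $\mathfrak g$ is a linear endomorphism $J$ of $\mathfrak g$ with $J^2=-1$; it induces the orientation for which the bases $(v_1,Jv_1,\dots,v_n,Jv_n)$ are positive. A symplectic form on $\mathfrak g$ is a nondegenerate alternating bilinear form $\omega:\mathfrak g\times\mathfrak g\to\mathbb R$ that is closed for the Chevalley–Eilenberg differential, i.e. $-\omega([x,y],z)+\omega([x,z],y)-\omega([y,z],x)=0$ for all $x,y,z\in\mathfrak g$. The structure $J$ is tamed by $\omega$ if $\omega(u,Ju)>0$ for all $u\ne 0$. If $\mathfrak g$ is not abelian, then there is an almost complex structure $J$ on $\mathfrak g$, inducing the given orientation, that is not tamed by any symplectic form on $\mathfrak g$. Hence every almost complex structure on $\mathfrak g$ is tamed by some symplectic form if and only if $\mathfrak g$ is abelian. -/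

import Mathlib

namespace LieTame

variable {𝔤 : Type*} [LieRing 𝔤] [LieAlgebra ℝ 𝔤]

/-- The Chevalley-Eilenberg differential (trivial real coefficients) of a `2`-form `ω` on a real
Lie algebra, as a function of three vectors. It is the extension by the Leibniz rule of
`dα (x, y) = - α [x, y]` on `1`-forms. -/
def ceDifferential (ω : LinearMap.BilinForm ℝ 𝔤) (x y z : 𝔤) : ℝ :=
  - ω ⁅x, y⁆ z + ω ⁅x, z⁆ y - ω ⁅y, z⁆ x

/-- A symplectic form on a real Lie algebra: a closed nondegenerate alternating `2`-form. -/
structure IsSymplecticForm (ω : LinearMap.BilinForm ℝ 𝔤) : Prop where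
  alt : ω.IsAlt
  nondegenerate : ω.Nondegenerate
  closed : ∀ x y z : 𝔤, ceDifferential ω x y z = 0

/-- An almost complex structure: a linear endomorphism `J` with `J ^ 2 = -1`. No integrability and
no relation with the bracket is required. -/
def IsAlmostComplex (J : Module.End ℝ 𝔤) : Prop :=
  J * J = -1

/-- `J` is tamed by some symplectic form `ω`, that is `ω (u, J u) > 0` for all `u ≠ 0`. -/
def IsTamed (J : Module.End ℝ 𝔤) : Prop :=
  ∃ ω : LinearMap.BilinForm ℝ 𝔤, IsSymplecticForm ω ∧ ∀ u : 𝔤, u ≠ 0 → 0 < ω u (J u)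

/-- The almost complex structure `J` induces the orientation `o`: some basis of the form
`(v₁, J v₁, v₂, J v₂, …, vₙ, J vₙ)` is positively oriented. (Since complex-linear automorphisms
have positive real determinant, all bases of this form define the same orientation.) -/
def InducesOrientation {n : ℕ} (J : Module.End ℝ 𝔤) (o : Orientation ℝ 𝔤 (Fin (2 * n))) : Prop :=
  ∃ b : Module.Basis (Fin (2 * n)) ℝ 𝔤,
    (∀ i : Fin n, b ⟨2 * i + 1, by omega⟩ = J (b ⟨2 * i, by omega⟩)) ∧ b.orientation = o

end LieTame

namespace LieTame

variable {𝔤 : Type*} [LieRing 𝔤] [LieAlgebra ℝ 𝔤]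

/-! A closed form kills every exact bivector, that is, every boundary `[x,y]∧z - [x,z]∧y + [y,z]∧x`.
If a sum of `u i ∧ v i` with independent factors is exact, put `J (u i) = v i`: a taming form would
make the sum of `ω (u i) (J (u i))` both zero and positive. So a nonzero exact bivector obstructs
taming, and such a boundary has rank `k ≤ 3`.

The orientation remains. If `k < n`, a basis vector outside the bivector can be negated. If `k = n =
3`, negating the bivector itself reverses the orientation. If `k = n = 2`, neither move is
available, so dimension four needs an exact bivector of rank one; `exists_exactPair_of_finrank_four`
finds it from the Jacobi identity. `exists_exactPair_or_linearIndependent` handles algebras whose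
planes are all subalgebras, again with rank one.

Conversely, on an abelian algebra every 2-form is closed, and averaging an inner product over `J`
gives a taming form. -/

/-- A closed alternating bilinear form. -/
def IsClosedForm (ω : LinearMap.BilinForm ℝ 𝔤) : Prop :=
  ω.IsAlt ∧ ∀ x y z : 𝔤, ceDifferential ω x y z = 0

/-- The bivector `u ∧ v` is killed by all closed forms. -/
def IsExactPair (u v : 𝔤) : Prop :=
  ∀ ω : LinearMap.BilinForm ℝ 𝔤, IsClosedForm ω → ω u v = 0

/-! ### Exact bivectors of rank one in dimension four -/

/-- Linear independence of four vectors in coordinates. -/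
def Indep4 (x y z t : 𝔤) : Prop :=
  ∀ a b c d : ℝ, a • x + b • y + c • z + d • t = 0 → a = 0 ∧ b = 0 ∧ c = 0 ∧ d = 0

theorem Indep4.linearIndependent {x y z t : 𝔤} (h : Indep4 x y z t) :
    LinearIndependent ℝ ![x, y, z, t] := by
  rw [Fintype.linearIndependent_iff]
  intro g hg
  simp only [Fin.sum_univ_four, Matrix.cons_val] at hg
  obtain ⟨h0, h1, h2, h3⟩ := h _ _ _ _ hg
  intro i
  fin_cases i <;> assumption

theorem Indep4.exists_coords (hd : Module.finrank ℝ 𝔤 = 4) {x y z t : 𝔤} (h : Indep4 x y z t)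
    (v : 𝔤) : ∃ a b c d : ℝ, v = a • x + b • y + c • z + d • t := by
  have : FiniteDimensional ℝ 𝔤 := Module.finite_of_finrank_pos (by omega)
  have hs := h.linearIndependent.span_eq_top_of_card_eq_finrank' (by simp [hd])
  have hv : v ∈ Submodule.span ℝ (Set.range ![x, y, z, t]) := by rw [hs]; trivial
  obtain ⟨c, hc⟩ := (Submodule.mem_span_range_iff_exists_fun ℝ).1 hv
  refine ⟨c 0, c 1, c 2, c 3, ?_⟩
  rw [← hc]
  simp [Fin.sum_univ_four]

/-- In this basis `ad x` is triangular up to order, with eigenvalues 0, 1/2, 1/2, 1, so 3/2 is not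
one of them. -/
theorem Indep4.eq_zero_of_lie_smul (hd : Module.finrank ℝ 𝔤 = 4) {x y z t v : 𝔤}
    (h : Indep4 x y z t) (q : ℝ) (hxy : ⁅x, y⁆ = (1 / 2 : ℝ) • y)
    (hxz : ⁅x, z⁆ = (1 / 2 : ℝ) • z + q • x) (hxt : ⁅x, t⁆ = t - (q / 2) • y)
    (hv : ⁅x, v⁆ = (3 / 2 : ℝ) • v) : v = 0 := by
  obtain ⟨a, b, c, d, rfl⟩ := h.exists_coords hd v
  simp only [lie_add, lie_smul, lie_self, hxy, hxz, hxt] at hv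
  obtain ⟨h1, h2, h3, h4⟩ := h (c * q - 3 / 2 * a) (b / 2 - d * q / 2 - 3 / 2 * b)
    (c / 2 - 3 / 2 * c) (d - 3 / 2 * d) (by linear_combination (norm := module) hv)
  have hd0 : d = 0 := by linarith
  have hc0 : c = 0 := by linarith
  subst hd0 hc0
  have hb0 : b = 0 := by linarith
  have ha0 : a = 0 := by linarith
  simp [ha0, hb0]

/-- The case where `ad x` is scalar on the plane `⟨y, z⟩` modulo `x`. -/
theorem exists_exactPair_of_scalar (hd : Module.finrank ℝ 𝔤 = 4) {x y z t : 𝔤}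
    (h : Indep4 x y z t) (p q : ℝ) (hxy : ⁅x, y⁆ = (1 / 2 : ℝ) • y + p • x)
    (hxz : ⁅x, z⁆ = (1 / 2 : ℝ) • z + q • x) (hyz : ⁅y, z⁆ = t) :
    ∃ u v : 𝔤, LinearIndependent ℝ ![u, v] ∧ IsExactPair u v := by
  wlog hp : p = 0 generalizing y t p
  -- The shift by `2p • x` turns `y` into a genuine eigenvector of `ad x` for 1/2.
  · refine this (y := y + (2 * p) • x) (t := t + (2 * p) • ((1 / 2 : ℝ) • z + q • x)) ?_ 0 ?_ ?_ rfl
    · intro a b c d e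
      obtain ⟨h1, h2, h3, h4⟩ := h (a + 2 * p * b + 2 * p * q * d) b (c + p * d) d
        (by linear_combination (norm := module) e)
      subst h2 h4
      refine ⟨by linarith, rfl, by linarith, rfl⟩
    · simp only [lie_add, lie_smul, lie_self, hxy]
      module
    · simp only [add_lie, smul_lie, hyz, hxz]
  subst hp
  simp only [zero_smul, add_zero] at hxy
  have hxt : ⁅x, t⁆ = t - (q / 2) • y := by
    rw [← hyz, leibniz_lie, hxy, hxz, hyz, ← lie_skew]
    simp only [lie_add, lie_smul, ← lie_skew y x, ← lie_skew z y, hyz, hxy]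
    module
  -- Eigenvalues add under the bracket: 1/2 + 1 = 3/2, the `q` term vanishing since `[y,y] = 0`.
  have hyt : ⁅y, t⁆ = 0 := by
    apply h.eq_zero_of_lie_smul hd q hxy hxz hxt
    rw [leibniz_lie, hxy, hxt]
    simp only [lie_sub, lie_smul, smul_lie, lie_self]
    module
  refine ⟨y, t, ?_, ?_⟩
  · rw [LinearIndependent.pair_iff]
    intro a b e
    obtain ⟨-, h2, -, h4⟩ := h 0 a 0 b (by linear_combination (norm := module) e)
    exact ⟨h2, h4⟩
  · rintro ω ⟨hω, hcl⟩
    have h0 := hcl x y t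
    have h1 := hω y
    have h2 := hω.neg_eq y t
    simp only [ceDifferential, hxy, hxt, hyt, map_smul, map_sub, LinearMap.smul_apply,
      LinearMap.sub_apply, smul_eq_mul, h1, map_zero, LinearMap.zero_apply] at h0
    linarith

/-- The case where `y` is a cyclic vector for the action of `ad x` on the plane `⟨y, z⟩`. -/
theorem exists_exactPair_of_cyclic (hd : Module.finrank ℝ 𝔤 = 4) {x y z t : 𝔤}
    (h : Indep4 x y z t) (d q : ℝ) (hxy : ⁅x, y⁆ = z)
    (hxz : ⁅x, z⁆ = z - d • y + q • x) (hyz : ⁅y, z⁆ = t) :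
    ∃ u v : 𝔤, LinearIndependent ℝ ![u, v] ∧ IsExactPair u v := by
  wlog hq : q = 0 generalizing y t q
  -- If `d = 0`, the `t`-coefficients of `[x,[y,t]]` and `[x,[z,t]]` give `w4 = q` and `w4 = -q`,
  -- hence `q = 0`.
  · have hd0 : d ≠ 0 := by
      rintro rfl
      have hxt : ⁅x, t⁆ = t - q • z := by
        rw [← hyz, leibniz_lie, hxy, hxz]
        simp only [lie_add, lie_sub, lie_smul, lie_self, ← lie_skew y x, hxy, hyz]
        module
      obtain ⟨v1, v2, v3, v4, hv⟩ := h.exists_coords hd ⁅y, t⁆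
      obtain ⟨w1, w2, w3, w4, hw⟩ := h.exists_coords hd ⁅z, t⁆
      have e1 : ⁅x, ⁅y, t⁆⁆ = ⁅z, t⁆ + ⁅y, t⁆ - q • t := by
        rw [leibniz_lie, hxy, hxt, lie_sub, lie_smul, hyz]
        module
      have e2 : ⁅x, ⁅z, t⁆⁆ = (2 : ℝ) • ⁅z, t⁆ + q • t - (q * q) • z := by
        rw [leibniz_lie, hxz, hxt]
        simp only [lie_sub, lie_smul, add_lie, smul_lie, sub_lie, hxt, lie_self]
        module
      rw [hv, hw] at e1
      rw [hw] at e2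
      simp only [lie_add, lie_smul, lie_self, hxy, hxz, hxt] at e1 e2
      obtain ⟨-, -, -, f1⟩ := h (q * v3 - w1 - v1) (-w2 - v2) (v2 + v3 - q * v4 - w3 - v3)
        (v4 - w4 - v4 + q) (by linear_combination (norm := module) e1)
      obtain ⟨-, -, -, f2⟩ := h (q * w3 - 2 * w1) (- 2 * w2) (w2 + w3 - q * w4 - 2 * w3 + q * q)
        (w4 - 2 * w4 - q) (by linear_combination (norm := module) e2)
      exact hq (by linarith)
    -- Chosen so that `-d • (y - s • x)` absorbs `q • x`.
    set s := q / d with hs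
    have hsd : s * d = q := by rw [hs]; field_simp
    refine this (y := y - s • x) (t := t - s • (z - d • y + q • x)) ?_ 0 ?_ ?_ ?_ rfl
    · intro a b c e he
      obtain ⟨h1, h2, h3, h4⟩ := h (a - s * b - s * q * e) (b + s * d * e) (c - s * e) e
        (by linear_combination (norm := module) he)
      subst h4
      simp only [mul_zero, add_zero] at h2
      subst h2
      refine ⟨by linarith, rfl, by linarith, rfl⟩
    · simp only [lie_sub, lie_smul, lie_self, hxy]
      module
    · rw [hxz, ← hsd]
      module
    · simp only [sub_lie, smul_lie, hyz, hxz]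
  subst hq
  simp only [zero_smul, add_zero] at hxz
  have hxt : ⁅x, t⁆ = t := by
    rw [← hyz, leibniz_lie, hxy, hxz]
    simp only [lie_sub, lie_smul, lie_self]
    module
  obtain ⟨v1, v2, v3, v4, hv⟩ := h.exists_coords hd ⁅y, t⁆
  obtain ⟨w1, w2, w3, w4, hw⟩ := h.exists_coords hd ⁅z, t⁆
  have e1 : ⁅x, ⁅y, t⁆⁆ = ⁅z, t⁆ + ⁅y, t⁆ := by rw [leibniz_lie, hxy, hxt]
  have e2 : ⁅x, ⁅z, t⁆⁆ = (2 : ℝ) • ⁅z, t⁆ - d • ⁅y, t⁆ := by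
    rw [leibniz_lie, hxz, hxt, sub_lie, smul_lie]
    module
  rw [hv, hw] at e1 e2
  simp only [lie_add, lie_smul, lie_self, hxy, hxz, hxt] at e1 e2
  obtain ⟨-, f2, f3, f4⟩ := h (-w1 - v1) (-d * v3 - w2 - v2) (v2 - w3)
    (- w4) (by linear_combination (norm := module) e1)
  obtain ⟨-, g2, g3, -⟩ := h (-2 * w1 + d * v1) (-d * w3 - 2 * w2 + d * v2)
    (w2 + w3 - 2 * w3 + d * v3) (w4 - 2 * w4 + d * v4) (by linear_combination (norm := module) e2)
  have hv2 : v2 = w3 := by linarith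
  subst hv2
  have hw2 : w2 = 0 := by linarith
  have hv2 : v2 = 0 := by linarith
  have hw4 : w4 = 0 := by linarith
  subst hw2 hv2 hw4
  simp only [zero_smul, add_zero] at hw
  -- Since `[z,t]` is a multiple of `x`, the boundary of `x∧z∧t` is this single product up to sign.
  refine ⟨(2 : ℝ) • z - d • y, t, ?_, ?_⟩
  · rw [LinearIndependent.pair_iff]
    intro a b e
    obtain ⟨-, -, h3, h4⟩ := h 0 (-a * d) (2 * a) b (by linear_combination (norm := module) e)
    exact ⟨by linarith, h4⟩
  · rintro ω ⟨hω, hcl⟩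
    have h0 := hcl x z t
    have h1 := hω x
    have h2 := hω.neg_eq z t
    simp only [ceDifferential, hxz, hxt, hw, map_smul, map_sub, LinearMap.smul_apply,
      LinearMap.sub_apply, smul_eq_mul, h1] at h0 ⊢
    linarith

/-- As `c ≠ 0`, `y` is cyclic modulo `x`; taking `[x,y]` as the new `z`, Cayley–Hamilton gives trace
1 and determinant `ad - bc`. -/
theorem exists_exactPair_of_ne_zero (hd : Module.finrank ℝ 𝔤 = 4) {x y z t : 𝔤}
    (h : Indep4 x y z t) (a b c d p q : ℝ) (hxy : ⁅x, y⁆ = a • y + c • z + p • x)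
    (hxz : ⁅x, z⁆ = b • y + d • z + q • x) (hyz : ⁅y, z⁆ = t) (htr : a + d = 1) (hc : c ≠ 0) :
    ∃ u v : 𝔤, LinearIndependent ℝ ![u, v] ∧ IsExactPair u v := by
  refine exists_exactPair_of_cyclic hd (x := x) (y := y) (z := a • y + c • z + p • x)
    (t := c • t - p • (a • y + c • z + p • x)) ?_ (a * d - b * c) (c * q - d * p) hxy ?_ ?_
  · intro r1 r2 r3 r4 e
    obtain ⟨h1, h2, h3, h4⟩ := h (r1 + p * r3 - p * p * r4) (r2 + a * r3 - p * a * r4)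
      (c * r3 - p * c * r4) (c * r4) (by linear_combination (norm := module) e)
    have h4 : r4 = 0 := by simpa [hc] using h4
    subst h4
    have h3 : r3 = 0 := by simpa [hc] using h3
    subst h3
    refine ⟨by linarith, by linarith, rfl, rfl⟩
  · obtain rfl : d = 1 - a := by linarith
    simp only [lie_add, lie_smul, lie_self, hxy, hxz]
    module
  · simp only [lie_add, lie_smul, lie_self, ← lie_skew y x, hxy, hyz]
    module

/-- A 2×2 matrix is scalar or has a cyclic vector, which can be found among `y`, `z`, `y + z`. -/
theorem exists_exactPair_of_trace_eq_one (hd : Module.finrank ℝ 𝔤 = 4) {x y z t : 𝔤}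
    (h : Indep4 x y z t) (a b c d p q : ℝ) (hxy : ⁅x, y⁆ = a • y + c • z + p • x)
    (hxz : ⁅x, z⁆ = b • y + d • z + q • x) (hyz : ⁅y, z⁆ = t) (htr : a + d = 1) :
    ∃ u v : 𝔤, LinearIndependent ℝ ![u, v] ∧ IsExactPair u v := by
  by_cases hc : c = 0
  swap
  · exact exists_exactPair_of_ne_zero hd h a b c d p q hxy hxz hyz htr hc
  by_cases hb : b = 0
  swap
  · refine exists_exactPair_of_ne_zero hd (x := x) (y := z) (z := -y) (t := t) ?_ d (-c) (-b) a
      q (-p) ?_ ?_ ?_ (by linarith) (by simpa using hb)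
    · intro r1 r2 r3 r4 e
      obtain ⟨h1, h2, h3, h4⟩ := h r1 (-r3) r2 r4 (by linear_combination (norm := module) e)
      exact ⟨h1, h3, by linarith, h4⟩
    · rw [hxz]; module
    · rw [lie_neg, hxy]; module
    · rw [lie_neg, lie_skew, hyz]
  subst hb hc
  by_cases had : a = d
  · obtain rfl : a = 1 / 2 := by linarith
    obtain rfl : d = 1 / 2 := by linarith
    exact exists_exactPair_of_scalar hd h p q (by rw [hxy]; module) (by rw [hxz]; module) hyz
  · refine exists_exactPair_of_ne_zero hd (x := x) (y := y + z) (z := z) (t := t) ?_ a 0 (d - a) d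
      (p + q) q ?_ ?_ ?_ htr (sub_ne_zero.2 (Ne.symm had))
    · intro r1 r2 r3 r4 e
      obtain ⟨h1, h2, h3, h4⟩ := h r1 r2 (r2 + r3) r4 (by linear_combination (norm := module) e)
      exact ⟨h1, h2, by linarith, h4⟩
    · rw [lie_add, hxy, hxz]; module
    · rw [hxz]; module
    · rw [add_lie, hyz, lie_self, add_zero]

/-- In dimension four, if `x, y, [x, y]` are independent for some `x, y`, then some nonzero
decomposable bivector is exact. -/
theorem exists_exactPair_of_finrank_four (hd : Module.finrank ℝ 𝔤 = 4) {y z : 𝔤}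
    (h : LinearIndependent ℝ ![y, z, ⁅y, z⁆]) :
    ∃ u v : 𝔤, LinearIndependent ℝ ![u, v] ∧ IsExactPair u v := by
  obtain ⟨x, hx⟩ := exists_linearIndependent_cons_of_lt_finrank h (by omega)
  have hI : Indep4 x y z ⁅y, z⁆ := by
    intro a b c d e
    have := Fintype.linearIndependent_iff.1 hx ![a, b, c, d]
      (by simpa [Fin.sum_univ_four, Fin.sum_univ_succ, ← add_assoc] using e)
    exact ⟨this 0, this 1, this 2, this 3⟩
  obtain ⟨a1, a2, a3, m, hm⟩ := hI.exists_coords hd ⁅x, y⁆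
  obtain ⟨b1, b2, b3, l, hl⟩ := hI.exists_coords hd ⁅x, z⁆
  set t := ⁅y, z⁆ with ht
  -- This correction removes the `t`-components of `[x,y]` and `[x,z]`, so `ad X` acts on `⟨y,z⟩`
  -- modulo `X`.
  set X := x - l • y + m • z with hX
  have hIX : Indep4 X y z t := by
    intro r1 r2 r3 r4 e
    obtain ⟨h1, h2, h3, h4⟩ := hI r1 (r2 - l * r1) (r3 + m * r1) r4
      (by rw [hX] at e; linear_combination (norm := module) e)
    subst h1
    exact ⟨rfl, by linarith, by linarith, h4⟩
  have hXy : ⁅X, y⁆ = (a2 + a1 * l) • y + (a3 - a1 * m) • z + a1 • X := by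
    rw [hX]
    simp only [add_lie, sub_lie, smul_lie, lie_self, ← lie_skew z y, hm, ← ht]
    module
  have hXz : ⁅X, z⁆ = (b2 + b1 * l) • y + (b3 - b1 * m) • z + b1 • X := by
    rw [hX]
    simp only [add_lie, sub_lie, smul_lie, lie_self, hl, ← ht]
    module
  clear_value X
  generalize a2 + a1 * l = a at *
  generalize b2 + b1 * l = b at *
  generalize a3 - a1 * m = c at *
  generalize b3 - b1 * m = d at *
  by_cases htr : a + d = 0
  -- In the boundary of `X∧y∧z` the coefficient of `y∧z` is the trace; when it vanishes, `X` factors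
  -- out.
  · refine ⟨t - a1 • z + b1 • y, X, ?_, ?_⟩
    · rw [LinearIndependent.pair_iff]
      intro r s e
      obtain ⟨h1, -, -, h4⟩ := hIX s (r * b1) (-r * a1) r (by linear_combination (norm := module) e)
      exact ⟨h4, h1⟩
    · rintro ω ⟨hω, hcl⟩
      have h0 := hcl X y z
      have h1 := hω y
      have h2 := hω z
      have h3 := hω.neg_eq y z
      have h4 := hω.neg_eq X y
      have h5 := hω.neg_eq X z
      obtain rfl : d = -a := by linarith
      simp only [ceDifferential, hXy, hXz, ← ht, map_smul, map_sub, map_add, LinearMap.smul_apply,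
        LinearMap.sub_apply, LinearMap.add_apply, smul_eq_mul, h1, h2, ← h3, ← h4, ← h5] at h0 ⊢
      linarith
  · set s := (a + d)⁻¹ with hs
    have hs0 : s ≠ 0 := inv_ne_zero htr
    refine exists_exactPair_of_trace_eq_one hd (x := s • X) (y := y) (z := z) (t := t) ?_
      (s * a) (s * b) (s * c) (s * d) a1 b1 ?_ ?_ rfl ?_
    · intro r1 r2 r3 r4 e
      obtain ⟨h1, h2, h3, h4⟩ := hIX (r1 * s) r2 r3 r4 (by linear_combination (norm := module) e)
      exact ⟨by simpa [hs0] using h1, h2, h3, h4⟩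
    · rw [smul_lie, hXy]; module
    · rw [smul_lie, hXz]; module
    · rw [hs]; field_simp

/-! ### Algebras in which every plane is a subalgebra -/

theorem linearIndependent_three_iff {V : Type*} [AddCommGroup V] [Module ℝ V] {x y z : V} :
    LinearIndependent ℝ ![x, y, z] ↔
      ∀ a b c : ℝ, a • x + b • y + c • z = 0 → a = 0 ∧ b = 0 ∧ c = 0 := by
  rw [Fintype.linearIndependent_iff]
  constructor
  · intro h a b c e
    have := h ![a, b, c] (by simpa [Fin.sum_univ_three] using e)
    exact ⟨this 0, this 1, this 2⟩
  · intro h g e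
    obtain ⟨h0, h1, h2⟩ := h (g 0) (g 1) (g 2) (by simpa [Fin.sum_univ_three] using e)
    intro i
    fin_cases i <;> assumption

/-- If every plane is a subalgebra, a noncommuting pair can be normalised to `[x, s] = s`. -/
theorem exists_lie_eq_self {x y : 𝔤} (h : LinearIndependent ℝ ![x, y]) (hne : ⁅x, y⁆ ≠ 0)
    (a b : ℝ) (hxy : ⁅x, y⁆ = a • x + b • y) :
    ∃ x s : 𝔤, LinearIndependent ℝ ![x, s] ∧ ⁅x, s⁆ = s := by
  rw [LinearIndependent.pair_iff] at h
  by_cases hb : b = 0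
  · subst hb
    have ha : a ≠ 0 := by
      rintro rfl
      exact hne (by simp [hxy])
    refine ⟨-a⁻¹ • y, x, ?_, ?_⟩
    · rw [LinearIndependent.pair_iff]
      intro r t e
      obtain ⟨h1, h2⟩ := h t (-r * a⁻¹) (by linear_combination (norm := module) e)
      exact ⟨by simpa [ha] using h2, h1⟩
    · rw [smul_lie, ← lie_skew, hxy, zero_smul, add_zero, smul_neg, smul_smul]
      simp [ha]
  · refine ⟨b⁻¹ • x, a • x + b • y, ?_, ?_⟩
    · rw [LinearIndependent.pair_iff]
      intro r t e
      obtain ⟨h1, h2⟩ := h (r * b⁻¹ + t * a) (t * b) (by linear_combination (norm := module) e)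
      obtain rfl : t = 0 := by simpa [hb] using h2
      exact ⟨by simpa [hb] using h1, rfl⟩
    · simp only [smul_lie, lie_add, lie_smul, lie_self, smul_zero, zero_add]
      rw [smul_smul, mul_inv_cancel₀ hb, one_smul, hxy]

theorem exists_exactPair_or_linearIndependent (hd : 3 ≤ Module.finrank ℝ 𝔤)
    (hab : ¬ IsLieAbelian 𝔤) :
    (∃ u v : 𝔤, LinearIndependent ℝ ![u, v] ∧ IsExactPair u v) ∨
      ∃ x y : 𝔤, LinearIndependent ℝ ![x, y, ⁅x, y⁆] := by
  rw [or_iff_not_imp_right]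
  intro hno
  have hplane : ∀ x y : 𝔤, LinearIndependent ℝ ![x, y] → ∃ a b : ℝ, ⁅x, y⁆ = a • x + b • y := by
    intro x y hxy
    rw [LinearIndependent.pair_iff] at hxy
    by_contra! hne
    refine hno ⟨x, y, linearIndependent_three_iff.2 fun a b c e => ?_⟩
    by_cases hc : c = 0
    · subst hc
      obtain ⟨h1, h2⟩ := hxy a b (by linear_combination (norm := module) e)
      exact ⟨h1, h2, rfl⟩
    · refine absurd ?_ (hne (-a / c) (-b / c))
      have : c⁻¹ • (a • x + b • y + c • ⁅x, y⁆) = 0 := by rw [e, smul_zero]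
      rw [smul_add, smul_smul c⁻¹ c, inv_mul_cancel₀ hc] at this
      linear_combination (norm := module) this
  obtain ⟨x, y, hxy⟩ : ∃ x y : 𝔤, ⁅x, y⁆ ≠ 0 := by
    by_contra! h
    exact hab ⟨h⟩
  have hI : LinearIndependent ℝ ![x, y] := by
    rw [LinearIndependent.pair_iff]
    intro a b e
    have h1 : a • ⁅x, y⁆ = 0 := by
      have : ⁅a • x + b • y, y⁆ = 0 := by rw [e, zero_lie]
      simpa using this
    have h2 : b • ⁅x, y⁆ = 0 := by
      have : ⁅x, a • x + b • y⁆ = 0 := by rw [e, lie_zero]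
      simpa using this
    exact ⟨(smul_eq_zero.1 h1).resolve_right hxy, (smul_eq_zero.1 h2).resolve_right hxy⟩
  obtain ⟨a, b, hlie⟩ := hplane x y hI
  obtain ⟨x, s, hxs, hs⟩ := exists_lie_eq_self hI hxy a b hlie
  obtain ⟨z, hz⟩ := exists_linearIndependent_cons_of_lt_finrank hxs (by omega)
  have h3 : ∀ a b c : ℝ, a • z + b • x + c • s = 0 → a = 0 ∧ b = 0 ∧ c = 0 :=
    linearIndependent_three_iff.1 hz
  have hp1 : LinearIndependent ℝ ![x, z] := by
    rw [LinearIndependent.pair_iff]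
    intro a b e
    obtain ⟨h1, h2, -⟩ := h3 b a 0 (by linear_combination (norm := module) e)
    exact ⟨h2, h1⟩
  have hp2 : LinearIndependent ℝ ![s, z] := by
    rw [LinearIndependent.pair_iff]
    intro a b e
    obtain ⟨h1, -, h2⟩ := h3 b 0 a (by linear_combination (norm := module) e)
    exact ⟨h2, h1⟩
  have hp3 : LinearIndependent ℝ ![x, s + z] := by
    rw [LinearIndependent.pair_iff]
    intro a b e
    obtain ⟨h1, h2, -⟩ := h3 b a b (by linear_combination (norm := module) e)
    exact ⟨h2, h1⟩
  obtain ⟨b, a, hxz⟩ := hplane x z hp1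
  obtain ⟨c, d, hsz⟩ := hplane s z hp2
  obtain ⟨e, f, hxsz⟩ := hplane x (s + z) hp3
  -- Closure of the plane `⟨x, s + z⟩` forces `z` to have the same `ad x`-eigenvalue as `s` modulo
  -- `x`.
  rw [lie_add, hs, hxz] at hxsz
  obtain ⟨h1, -, h2⟩ := h3 (a - f) (b - e) (1 - f) (by linear_combination (norm := module) hxsz)
  obtain rfl : a = 1 := by linarith
  -- These are the two factors of the boundary of `x∧s∧z`, up to sign.
  refine ⟨s - (d / 2) • x, (2 : ℝ) • z + (b + c) • x, ?_, ?_⟩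
  · rw [LinearIndependent.pair_iff]
    intro r t e
    obtain ⟨h1, -, h2⟩ := h3 (2 * t) (t * (b + c) - r * (d / 2)) r
      (by linear_combination (norm := module) e)
    exact ⟨h2, by linarith⟩
  · rintro ω ⟨hω, hcl⟩
    have h0 := hcl x s z
    have k1 := hω x
    have k2 := hω s
    have k3 := hω.neg_eq x z
    have k4 := hω.neg_eq x s
    have k5 := hω.neg_eq s z
    simp only [ceDifferential, hs, hxz, hsz, map_smul, map_sub, map_add, LinearMap.smul_apply,
      LinearMap.sub_apply, LinearMap.add_apply, smul_eq_mul, k1, ← k3, ← k4, ← k5] at h0 ⊢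
    linarith

/-! ### Writing bivectors with independent factors -/

section Rank

variable {V : Type*} [AddCommGroup V] [Module ℝ V]

/-- After substituting for `v j`, the product `u j ∧ v j` is spread over the other pairs: `(u i + b
i u j) ∧ (v i - a i u j)` has no extra term because `u j ∧ u j = 0`. -/
theorem exists_fewer_pairs_of_right_eq {k : ℕ} (u v : Fin (k + 1) → V) (j : Fin (k + 1))
    (c : ℝ) (a b : Fin k → ℝ)
    (hj : v j = c • u j + ∑ i, (a i • u (j.succAbove i) + b i • v (j.succAbove i))) :
    ∃ u' v' : Fin k → V, ∀ ω : LinearMap.BilinForm ℝ V, ω.IsAlt →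
      ∑ i, ω (u' i) (v' i) = ∑ i, ω (u i) (v i) := by
  refine ⟨fun i => u (j.succAbove i) + b i • u j, fun i => v (j.succAbove i) - a i • u j,
    fun ω hω => ?_⟩
  rw [Fin.sum_univ_succAbove _ j, hj]
  simp only [map_add, map_smul, map_sum, map_sub, LinearMap.add_apply, LinearMap.smul_apply,
    smul_eq_mul, hω (u j), mul_zero, zero_add]
  rw [← Finset.sum_add_distrib]
  refine Finset.sum_congr rfl fun i _ => ?_
  have := hω.neg_eq (u j) (u (j.succAbove i))
  rw [← this]
  ring

/-- A sum of `k + 1` simple bivectors whose `2k + 2` factors are dependent is a sum of `k` simple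
bivectors. -/
theorem exists_fewer_pairs {k : ℕ} (u v : Fin (k + 1) → V)
    (h : ¬ LinearIndependent ℝ (Sum.elim u v)) :
    ∃ u' v' : Fin k → V, ∀ ω : LinearMap.BilinForm ℝ V, ω.IsAlt →
      ∑ i, ω (u' i) (v' i) = ∑ i, ω (u i) (v i) := by
  rw [Fintype.not_linearIndependent_iff] at h
  obtain ⟨g, hg, l, hl⟩ := h
  simp only [Fintype.sum_sum_type, Sum.elim_inl, Sum.elim_inr] at hg
  obtain j | j := l
  · rw [Fin.sum_univ_succAbove _ j, Fin.sum_univ_succAbove _ j] at hg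
    -- The relation is solved for some `u j`; the roles are exchanged by `u∧v = v∧(-u)`.
    obtain ⟨u', v', h'⟩ := exists_fewer_pairs_of_right_eq v (fun i => - u i) j
      (g (.inr j) / g (.inl j)) (fun i => g (.inr (j.succAbove i)) / g (.inl j))
      (fun i => - g (.inl (j.succAbove i)) / g (.inl j)) (by
        have := congrArg (fun w => (g (.inl j))⁻¹ • w) hg
        simp only [smul_add, smul_smul, Finset.smul_sum, inv_mul_cancel₀ hl, smul_zero] at this
        simp only [Finset.sum_add_distrib, smul_neg, neg_div, neg_smul, neg_neg]
        simp only [div_eq_inv_mul]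
        linear_combination (norm := module) -this)
    refine ⟨u', v', fun ω hω => (h' ω hω).trans (Finset.sum_congr rfl fun i _ => ?_)⟩
    rw [map_neg, hω.neg_eq]
  · rw [Fin.sum_univ_succAbove _ j, Fin.sum_univ_succAbove _ j] at hg
    refine exists_fewer_pairs_of_right_eq u v j
      (- g (.inl j) / g (.inr j)) (fun i => - g (.inl (j.succAbove i)) / g (.inr j))
      (fun i => - g (.inr (j.succAbove i)) / g (.inr j)) ?_
    have := congrArg (fun w => (g (.inr j))⁻¹ • w) hg
    simp only [smul_add, smul_smul, Finset.smul_sum, inv_mul_cancel₀ hl, smul_zero] at this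
    simp only [Finset.sum_add_distrib, neg_div, neg_smul, Finset.sum_neg_distrib]
    simp only [div_eq_inv_mul]
    linear_combination (norm := module) this

/-- Every nonzero sum of `k` simple bivectors is a sum of `k' ≤ k` simple bivectors with
independent factors. -/
theorem exists_linearIndependent_pairs (k : ℕ) (u v : Fin k → V)
    (h : ∃ ω : LinearMap.BilinForm ℝ V, ω.IsAlt ∧ ∑ i, ω (u i) (v i) ≠ 0) :
    ∃ (k' : ℕ) (u' v' : Fin k' → V), 1 ≤ k' ∧ k' ≤ k ∧ LinearIndependent ℝ (Sum.elim u' v') ∧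
      ∀ ω : LinearMap.BilinForm ℝ V, ω.IsAlt → ∑ i, ω (u' i) (v' i) = ∑ i, ω (u i) (v i) := by
  induction k with
  | zero =>
    obtain ⟨ω, -, hne⟩ := h
    simp at hne
  | succ k ih =>
    by_cases hI : LinearIndependent ℝ (Sum.elim u v)
    · exact ⟨k + 1, u, v, by omega, le_rfl, hI, fun _ _ => rfl⟩
    · obtain ⟨u', v', h'⟩ := exists_fewer_pairs u v hI
      obtain ⟨k', u'', v'', h1, hk, hI', h''⟩ := ih u' v' (by
        obtain ⟨ω, hω, hne⟩ := h
        exact ⟨ω, hω, by rwa [h' ω hω]⟩)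
      exact ⟨k', u'', v'', h1, by omega, hI', fun ω hω => (h'' ω hω).trans (h' ω hω)⟩

end Rank

/-! ### Exact families of rank at most three -/

/-- Independent vectors `u i`, `v i` with `∑ u i ∧ v i` killed by all closed forms. -/
def IsExactFamily {k : ℕ} (u v : Fin k → 𝔤) : Prop :=
  LinearIndependent ℝ (Sum.elim u v) ∧
    ∀ ω : LinearMap.BilinForm ℝ 𝔤, IsClosedForm ω → ∑ i, ω (u i) (v i) = 0

theorem exists_dual_apply_eq {ι V : Type*} [AddCommGroup V] [Module ℝ V] {v : ι → V}
    (h : LinearIndependent ℝ v) (c : ι → ℝ) : ∃ f : Module.Dual ℝ V, ∀ i, f (v i) = c i := by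
  obtain ⟨f, hf⟩ := ((Module.Basis.span h).constr ℝ c).exists_extend
  refine ⟨f, fun i => ?_⟩
  have h1 : f (Module.Basis.span h i) = (Module.Basis.span h).constr ℝ c (Module.Basis.span h i) := by
    rw [← hf]; rfl
  rwa [Module.Basis.constr_basis, Module.Basis.span_apply] at h1

theorem exists_exactFamily_of_exactPair {u v : 𝔤} (h : LinearIndependent ℝ ![u, v])
    (he : IsExactPair u v) : ∃ u v : Fin 1 → 𝔤, IsExactFamily u v := by
  refine ⟨fun _ => u, fun _ => v, ?_, fun ω hω => by simpa using he ω hω⟩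
  rw [LinearIndependent.pair_iff] at h
  rw [Fintype.linearIndependent_iff]
  intro g hg
  obtain ⟨h1, h2⟩ := h (g (.inl 0)) (g (.inr 0)) (by simpa using hg)
  rintro (i | i) <;> rw [Subsingleton.elim i 0] <;> assumption

theorem exists_exactFamily_le_three (hd : 4 ≤ Module.finrank ℝ 𝔤) {x y : 𝔤}
    (h : LinearIndependent ℝ ![x, y, ⁅x, y⁆]) :
    ∃ (k : ℕ) (u v : Fin k → 𝔤), 1 ≤ k ∧ k ≤ 3 ∧ IsExactFamily u v := by
  obtain ⟨z, hz⟩ := exists_linearIndependent_cons_of_lt_finrank h (by omega)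
  obtain ⟨k, u, v, h1, hk, hI, he⟩ := exists_linearIndependent_pairs 3
    ![⁅x, y⁆, -⁅x, z⁆, ⁅y, z⁆] ![z, y, x] (by
      obtain ⟨f, hf⟩ := exists_dual_apply_eq hz ![0, 0, 0, 1]
      obtain ⟨g, hg⟩ := exists_dual_apply_eq hz ![1, 0, 0, 0]
      have hf0 : f z = 0 := hf 0
      have hf1 : f x = 0 := hf 1
      have hf2 : f y = 0 := hf 2
      have hf3 : f ⁅x, y⁆ = 1 := hf 3
      have hg0 : g z = 1 := hg 0
      have hg1 : g x = 0 := hg 1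
      have hg2 : g y = 0 := hg 2
      have hg3 : g ⁅x, y⁆ = 0 := hg 3
      -- The form `f∧g` detects `[x,y]∧z`, while the other two terms have a factor `x` or `y` killed
      -- by both `f` and `g`.
      refine ⟨LinearMap.BilinForm.linMulLin f g - LinearMap.BilinForm.linMulLin g f,
        fun w => ?_, ?_⟩
      · simp [mul_comm]
      · simp [Fin.sum_univ_three, hf0, hf1, hf2, hf3, hg0, hg1, hg2, hg3])
  refine ⟨k, u, v, h1, hk, hI, fun ω hω => ?_⟩
  rw [he ω hω.1]
  have := hω.2 x y z
  simp only [ceDifferential] at this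
  simp only [Fin.sum_univ_three, Matrix.cons_val, map_neg, LinearMap.neg_apply]
  have h := he ω hω.1
  linarith

/-! ### Adapted bases, orientations and almost complex structures -/

/-- Any independent family indexed by `Fin m` extends to one indexed by `Fin N`, `N` being the
dimension. -/
theorem exists_linearIndependent_extend {V : Type*} [AddCommGroup V] [Module ℝ V] {N : ℕ}
    (hN : Module.finrank ℝ V = N) {m : ℕ} (hm : m ≤ N) (f : ℕ → V)
    (hf : LinearIndependent ℝ (fun i : Fin m => f i)) :
    ∃ g : ℕ → V, (∀ i < m, g i = f i) ∧ LinearIndependent ℝ (fun i : Fin N => g i) := by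
  induction hm using Nat.decreasingInduction generalizing f with
  | self => exact ⟨f, fun _ _ => rfl, hf⟩
  | of_succ m hm ih =>
    obtain ⟨x, hx⟩ := exists_linearIndependent_snoc_of_lt_finrank hf (by omega)
    obtain ⟨g, hg, hI⟩ := ih (Function.update f m x) (by
      have : (fun i : Fin (m + 1) => Function.update f m x i) =
          Fin.snoc (α := fun _ => V) (fun i : Fin m => f i) x := by
        ext i
        refine Fin.lastCases ?_ (fun i => ?_) i
        · simp
        · simp [Function.update_of_ne i.2.ne]
      rwa [this])
    refine ⟨g, fun i hi => ?_, hI⟩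
    rw [hg i (by omega), Function.update_of_ne hi.ne]

/-- A family of `k` pairs with independent entries is the beginning of a basis. -/
theorem exists_basis_of_pairs {V : Type*} [AddCommGroup V] [Module ℝ V] {n k : ℕ}
    (hn : Module.finrank ℝ V = 2 * n) (hpos : 0 < n) (hk : k ≤ n) (u v : Fin k → V)
    (h : LinearIndependent ℝ (Sum.elim u v)) :
    ∃ b : Module.Basis (Fin (2 * n)) ℝ V, ∀ i : Fin k,
      b ⟨2 * i, by omega⟩ = u i ∧ b ⟨2 * i + 1, by omega⟩ = v i := by
  let e : Fin (2 * k) → Fin k ⊕ Fin k := fun i =>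
    if i.1 % 2 = 0 then .inl ⟨i / 2, by omega⟩ else .inr ⟨i / 2, by omega⟩
  have he : Function.Injective e := by
    intro i j hij
    simp only [e] at hij
    ext
    split_ifs at hij <;> simp at hij <;> omega
  obtain ⟨g, hg, hI⟩ := exists_linearIndependent_extend hn (m := 2 * k) (by omega)
    (fun i => if hi : i < 2 * k then Sum.elim u v (e ⟨i, hi⟩) else 0) (by
      simpa [Function.comp_def] using h.comp e he)
  have : Nonempty (Fin (2 * n)) := ⟨⟨0, by omega⟩⟩
  refine ⟨basisOfLinearIndependentOfCardEqFinrank hI (by simp [hn]), fun i => ⟨?_, ?_⟩⟩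
  · rw [coe_basisOfLinearIndependentOfCardEqFinrank]
    simp only
    rw [hg _ (by omega), dif_pos (by omega)]
    simp [e]
  · rw [coe_basisOfLinearIndependentOfCardEqFinrank]
    simp only
    rw [hg _ (by omega), dif_pos (by omega)]
    have h1 : (2 * i.1 + 1) % 2 = 1 := by omega
    have h2 : (2 * i.1 + 1) / 2 = i.1 := by omega
    simp [e, h1, h2]

/-- Negating all odd vectors of a basis of a six-dimensional space reverses its orientation. -/
theorem exists_basis_neg_odd {V : Type*} [AddCommGroup V] [Module ℝ V]
    (b : Module.Basis (Fin 6) ℝ V) :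
    ∃ b' : Module.Basis (Fin 6) ℝ V, b'.orientation = -b.orientation ∧
      ∀ i : Fin 3, b' ⟨2 * i, by omega⟩ = b ⟨2 * i, by omega⟩ ∧
        b' ⟨2 * i + 1, by omega⟩ = -b ⟨2 * i + 1, by omega⟩ := by
  refine ⟨b.unitsSMul ![1, -1, 1, -1, 1, -1], ?_, fun i => ?_⟩
  · rw [Module.Basis.orientation_unitsSMul]
    simp [Fin.prod_univ_succ]
  · fin_cases i <;> simp [Module.Basis.unitsSMul_apply, Units.smul_def]

/-- The almost complex structure attached to a basis `(v₁, w₁, …, vₙ, wₙ)`. -/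
theorem exists_isAlmostComplex_of_basis {n : ℕ} (b : Module.Basis (Fin (2 * n)) ℝ 𝔤) :
    ∃ J : Module.End ℝ 𝔤, IsAlmostComplex J ∧
      ∀ i : Fin n, b ⟨2 * i + 1, by omega⟩ = J (b ⟨2 * i, by omega⟩) := by
  -- The truncated `i - 1` is harmless, as it occurs only for odd `i`.
  let J : Module.End ℝ 𝔤 := b.constr ℝ fun i =>
    if h : i.1 % 2 = 0 then b ⟨i + 1, by omega⟩ else - b ⟨i - 1, by omega⟩
  have h0 : ∀ i : Fin n, J (b ⟨2 * i, by omega⟩) = b ⟨2 * i + 1, by omega⟩ := by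
    intro i
    rw [Module.Basis.constr_basis, dif_pos (by simp)]
  have h1 : ∀ i : Fin n, J (b ⟨2 * i + 1, by omega⟩) = - b ⟨2 * i, by omega⟩ := by
    intro i
    rw [Module.Basis.constr_basis, dif_neg (by simp)]
    simp
  refine ⟨J, b.ext fun i => ?_, fun i => (h0 i).symm⟩
  obtain ⟨i, hi⟩ := i
  obtain h | h := Nat.even_or_odd' i |>.choose_spec
  all_goals generalize (Nat.even_or_odd' i).choose = j at h; subst h
  · have := h0 ⟨j, by omega⟩
    have h1 := h1 ⟨j, by omega⟩
    simp only at this h1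
    simp [Module.End.mul_apply, this, h1]
  · have := h0 ⟨j, by omega⟩
    have h1 := h1 ⟨j, by omega⟩
    simp only at this h1
    simp [Module.End.mul_apply, this, h1]

theorem not_isTamed_of_sum_eq_zero {J : Module.End ℝ 𝔤} {k : ℕ} (hk : 1 ≤ k) (u : Fin k → 𝔤)
    (hu : ∀ i, u i ≠ 0)
    (h : ∀ ω : LinearMap.BilinForm ℝ 𝔤, IsClosedForm ω → ∑ i, ω (u i) (J (u i)) = 0) :
    ¬ IsTamed J := by
  rintro ⟨ω, hω, hpos⟩
  have : NeZero k := ⟨by omega⟩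
  have h0 := h ω ⟨hω.alt, hω.closed⟩
  have : 0 < ∑ i, ω (u i) (J (u i)) :=
    Finset.sum_pos (fun i _ => hpos _ (hu i)) ⟨0, Finset.mem_univ _⟩
  linarith

theorem exists_not_isTamed_of_basis {n k : ℕ} (hk1 : 1 ≤ k) (hk : k ≤ n)
    (b : Module.Basis (Fin (2 * n)) ℝ 𝔤)
    (h : ∀ ω : LinearMap.BilinForm ℝ 𝔤, IsClosedForm ω →
      ∑ i : Fin k, ω (b ⟨2 * i, by omega⟩) (b ⟨2 * i + 1, by omega⟩) = 0) :
    ∃ J : Module.End ℝ 𝔤, IsAlmostComplex J ∧ InducesOrientation J b.orientation ∧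
      ¬ IsTamed J := by
  obtain ⟨J, hJ, hb⟩ := exists_isAlmostComplex_of_basis b
  refine ⟨J, hJ, ⟨b, hb, rfl⟩, not_isTamed_of_sum_eq_zero hk1
    (fun i : Fin k => b ⟨2 * i, by omega⟩) (fun i => b.ne_zero _) fun ω hω => ?_⟩
  rw [← h ω hω]
  exact Finset.sum_congr rfl fun i _ => by rw [← hb ⟨i, by omega⟩]

theorem exists_not_isTamed_of_exactFamily {n k : ℕ} (hdim : Module.finrank ℝ 𝔤 = 2 * n)
    (o : Orientation ℝ 𝔤 (Fin (2 * n))) (hk1 : 1 ≤ k) (hk : k < n ∨ k = 3 ∧ n = 3)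
    {u v : Fin k → 𝔤} (h : IsExactFamily u v) :
    ∃ J : Module.End ℝ 𝔤, IsAlmostComplex J ∧ InducesOrientation J o ∧ ¬ IsTamed J := by
  have hkn : k ≤ n := by omega
  obtain ⟨b, hb⟩ := exists_basis_of_pairs hdim (by omega) hkn u v h.1
  have hsum : ∀ ω : LinearMap.BilinForm ℝ 𝔤, IsClosedForm ω →
      ∑ i : Fin k, ω (b ⟨2 * i, by omega⟩) (b ⟨2 * i + 1, by omega⟩) = 0 := by
    intro ω hω
    rw [← h.2 ω hω]
    exact Finset.sum_congr rfl fun i _ => by rw [(hb i).1, (hb i).2]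
  obtain rfl | rfl := b.orientation_eq_or_eq_neg o
  · exact exists_not_isTamed_of_basis hk1 hkn b hsum
  obtain hlt | ⟨rfl, rfl⟩ := hk
  -- As `k < n`, the last basis vector does not occur in the sum.
  · let l : Fin (2 * n) := ⟨2 * n - 1, by omega⟩
    rw [← b.orientation_neg_single l]
    refine exists_not_isTamed_of_basis hk1 hkn _ fun ω hω => ?_
    rw [← hsum ω hω]
    refine Finset.sum_congr rfl fun i _ => ?_
    rw [Module.Basis.unitsSMul_apply, Module.Basis.unitsSMul_apply,
      Function.update_of_ne (by simp [l]; omega), Function.update_of_ne (by simp [l]; omega)]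
    simp
  · obtain ⟨b', ho, hb'⟩ := exists_basis_neg_odd b
    rw [← ho]
    refine exists_not_isTamed_of_basis hk1 hkn b' fun ω hω => ?_
    rw [← neg_eq_zero, ← Finset.sum_neg_distrib, ← hsum ω hω]
    exact Finset.sum_congr rfl fun i _ => by rw [(hb' i).1, (hb' i).2, map_neg, neg_neg]

theorem exists_not_isTamed {n : ℕ} (hn : 4 ≤ 2 * n) (hdim : Module.finrank ℝ 𝔤 = 2 * n)
    (o : Orientation ℝ 𝔤 (Fin (2 * n))) (hab : ¬ IsLieAbelian 𝔤) :
    ∃ J : Module.End ℝ 𝔤, IsAlmostComplex J ∧ InducesOrientation J o ∧ ¬ IsTamed J := by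
  by_cases hpair : ∃ u v : 𝔤, LinearIndependent ℝ ![u, v] ∧ IsExactPair u v
  · obtain ⟨u, v, hI, he⟩ := hpair
    obtain ⟨u, v, h⟩ := exists_exactFamily_of_exactPair hI he
    exact exists_not_isTamed_of_exactFamily hdim o le_rfl (by omega) h
  · obtain h | ⟨x, y, hxy⟩ := exists_exactPair_or_linearIndependent (by omega) hab
    · exact absurd h hpair
    have hn2 : n ≠ 2 := by
      rintro rfl
      exact hpair (exists_exactPair_of_finrank_four hdim hxy)
    obtain ⟨k, u, v, hk1, hk, h⟩ := exists_exactFamily_le_three (by omega) hxy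
    exact exists_not_isTamed_of_exactFamily hdim o hk1 (by omega) h

/-! ### The abelian case -/

theorem isTamed_of_isLieAbelian [FiniteDimensional ℝ 𝔤] [IsLieAbelian 𝔤] {J : Module.End ℝ 𝔤}
    (hJ : IsAlmostComplex J) : IsTamed J := by
  have hJJ : ∀ u, J (J u) = -u := fun u => by
    have := LinearMap.congr_fun hJ u
    simpa using this
  let b := Module.finBasis ℝ 𝔤
  let g : LinearMap.BilinForm ℝ 𝔤 := ∑ i, LinearMap.BilinForm.linMulLin (b.coord i) (b.coord i)
  have hg : ∀ u v, g u v = ∑ i, b.coord i u * b.coord i v := fun u v => by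
    simp [g, LinearMap.sum_apply]
  have hsymm : ∀ u v, g u v = g v u := fun u v => by simp only [hg, mul_comm]
  have hnonneg : ∀ u, 0 ≤ g u u := fun u => by
    rw [hg]
    exact Finset.sum_nonneg fun i _ => mul_self_nonneg _
  have hpos : ∀ u, u ≠ 0 → 0 < g u u := by
    intro u hu
    refine (hnonneg u).lt_of_ne' fun h => hu ?_
    rw [hg, Finset.sum_eq_zero_iff_of_nonneg fun i _ => mul_self_nonneg _] at h
    exact b.forall_coord_eq_zero_iff.1 fun i => mul_self_eq_zero.1 (h i (Finset.mem_univ i))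
  -- Antisymmetrised so that `ω(u, Ju) = g(Ju, Ju) + g(u, u)`.
  let ω : LinearMap.BilinForm ℝ 𝔤 := g.comp J LinearMap.id - g.comp LinearMap.id J
  have hω : ∀ u v, ω u v = g (J u) v - g u (J v) := fun u v => rfl
  have htame : ∀ u, u ≠ 0 → 0 < ω u (J u) := by
    intro u hu
    rw [hω, hJJ, map_neg]
    linarith [hpos u hu, hnonneg (J u)]
  have halt : ω.IsAlt := fun u => by rw [hω, hsymm, sub_self]
  refine ⟨ω, ⟨halt, ?_, fun x y z => ?_⟩, htame⟩
  · refine (LinearMap.BilinForm.IsAlt.isRefl halt).nondegenerate_iff_separatingLeft.2 fun u hu => ?_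
    by_contra hne
    exact (htame u hne).ne' (hu _)
  · simp [ceDifferential, trivial_lie_zero]

end LieTame

theorem proposition4p1 {𝔤 : Type*} [LieRing 𝔤] [LieAlgebra ℝ 𝔤] (n : ℕ) (hn : 4 ≤ 2 * n)
    (hdim : Module.finrank ℝ 𝔤 = 2 * n) (o : Orientation ℝ 𝔤 (Fin (2 * n))) :
    (¬ IsLieAbelian 𝔤 →
      ∃ J : Module.End ℝ 𝔤, LieTame.IsAlmostComplex J ∧ LieTame.InducesOrientation J o ∧
        ¬ LieTame.IsTamed J) ∧
    ((∀ J : Module.End ℝ 𝔤, LieTame.IsAlmostComplex J → LieTame.IsTamed J) ↔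
      IsLieAbelian 𝔤) := by
  refine ⟨LieTame.exists_not_isTamed hn hdim o, fun h => ?_, fun h J hJ => ?_⟩
  · by_contra hab
    obtain ⟨J, hJ, -, hnot⟩ := LieTame.exists_not_isTamed hn hdim o hab
    exact hnot (h J hJ)
  · have : FiniteDimensional ℝ 𝔤 := Module.finite_of_finrank_pos (by omega)
    exact LieTame.isTamed_of_isLieAbelian hJ
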